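/- Let $K\ge 2$ and $n,m\ge 0$ be integers, let $q=\max(m,n)$, and let $D$ be the $q\times q$ shift matrix over $\mathbb F_2$ (it moves every coordinate down by one place and puts $0$ on top). In the $K$-user symmetric linear deterministic interference channel, transmitter $k$ sends $X_{k,i}\in\mathbb F_2^q$ at time $i$, and receiver $k$ observes $$Y_{k,i}=D^{q-n}X_{k,i}+\sum_{j\ne k}D^{q-m}X_{j,i}\qquad(1\le k\le K).$$ There is a noiseless feedback link of capacity $p$ from each receiver $k$ to transmitter $k$: in a block of $N$ channel uses, receiver $k$ feeds back at most $Np$ bits, those sent at time $i$ being a function of $Y_{k,1},\dots,Y_{k,i-1}$, and $X_{k,i}$ is a function of the message $W_k$ of user $k$ and of the bits that transmitter $k$ has received over its feedback link up to time $i$. A symmetric rate $R$ is achievable if, for some block length $N\ge1$, there is such a scheme with at least $2^{NR}$ messages per user in which every receiver $k$ recovers $W_k$ from $Y_{k,1},\dots,Y_{k,N}$ without error, for all choices of the messages. Let $C_{sym,\infty}$ and $C_{sym,0}$ be the suprema of the achievable symmetric rates with unlimited feedback ($p=\infty$) and without feedback ($p=0$). Let $p\ge0$ be finite and let $2p$ be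 an integer. Then the symmetric rate $$R_{sym}=\begin{cases}\min\{n-m+p,\ n-\frac m2\}, & 0\le m\le \frac n2,\\ \min\{m+p,\ n-\frac m2\}, & \frac n2\le m\le \frac{2n}3,\\ n-\frac m2, & \frac{2n}3\le m<n,\\ \frac nK, & m=n,\\ \frac m2, & n<m\le 2n,\\ \min\{n+p,\ \frac m2\}, & 2n\le m\end{cases}$$ is achievable with feedback links of capacity $p$. Moreover, $$R_{sym}=\min\{C_{sym,\infty},\ C_{sym,0}+p\}.$$ -/

import Mathlib

open scoped NNReal ENNReal Matrix

/-- A channel symbol: `q` bits, index `0` being the most significant level. -/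
abbrev LevelVec (q : ℕ) : Type := Fin q → ZMod 2

/-- The `q × q` shift matrix over `𝔽₂`: it moves every level down by one and puts `0` on top. -/
def shiftMatrix (q : ℕ) : Matrix (Fin q) (Fin q) (ZMod 2) :=
  Matrix.of fun i j => if (i : ℕ) = (j : ℕ) + 1 then 1 else 0

/-- One use of the `K`-user symmetric linear deterministic interference channel with direct gain
`n` and cross gain `m`: with `q = max n m`, receiver `k` observes
`D ^ (q - n) X_k + ∑_{j ≠ k} D ^ (q - m) X_j`. -/
def detChannel {K : ℕ} (n m : ℕ) (X : Fin K → LevelVec (max n m)) (k : Fin K) : LevelVec (max n m) :=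
  (shiftMatrix (max n m) ^ (max n m - n)) *ᵥ X k +
    ∑ j ∈ Finset.univ.erase k, (shiftMatrix (max n m) ^ (max n m - m)) *ᵥ X j

/-- A block code of length `N` with causal feedback from receiver `k` to transmitter `k`, for `K`
users with `M` messages each. Times are `0, 1, …, N - 1`. -/
structure FeedbackCode (K q N : ℕ) where
  /-- the number of messages of each user -/
  M : ℕ
  /-- the number of bits sent at time `t` over the feedback link of user `k` -/
  fbBits : Fin K → ℕ → ℕ
  /-- the bits fed back by receiver `k` at time `t`, from its outputs at the times `r < t` -/
  feedback : (k : Fin K) → (t : ℕ) → (Fin t → LevelVec q) → (Fin (fbBits k t) → ZMod 2)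
  /-- the input of transmitter `k` at time `t`, from its message and from the bits it received
  over its feedback link at the times `s ≤ t` -/
  encode : (k : Fin K) → (t : ℕ) → Fin M →
    ((s : Fin (t + 1)) → Fin (fbBits k s) → ZMod 2) → LevelVec q
  /-- the decoder of receiver `k` -/
  decode : Fin K → (Fin N → LevelVec q) → Fin M

/-- The outputs at time `t`, at all receivers, when the code `c` is used over the channel with
gains `n`, `m` and the users send the messages `W`. -/
def FeedbackCode.output {K n m N : ℕ} (c : FeedbackCode K (max n m) N) (W : Fin K → Fin c.M)
    (t : ℕ) : Fin K → LevelVec (max n m) :=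
  detChannel n m fun k =>
    c.encode k t (W k) fun s => c.feedback k s fun r => c.output W r k
termination_by t
decreasing_by
  have h1 := r.isLt
  omega

/-- The symmetric rate `R` (in bits per channel use and user) is achievable with feedback links of
capacity `F`: some block code of some length `N ≥ 1` sends over each feedback link at most `F` bits
per channel use (that is, at most `N F` bits in the block), has at least `2 ^ (N R)` messages for
each user, and every receiver always recovers its message. `F = ∞` is unlimited feedback and
`F = 0` is no feedback. -/
def SymAchievable (K n m : ℕ) (F : ℝ≥0∞) (R : ℝ) : Prop :=
  ∃ N : ℕ, 0 < N ∧ ∃ c : FeedbackCode K (max n m) N,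
    (∀ k, ((∑ t ∈ Finset.range N, c.fbBits k t : ℕ) : ℝ≥0∞) ≤ N * F) ∧
    (2 : ℝ) ^ ((N : ℝ) * R) ≤ (c.M : ℝ) ∧
    ∀ (W : Fin K → Fin c.M) (k : Fin K),
      c.decode k (fun t => c.output W t k) = W k

/-- `C` is the symmetric capacity with feedback links of capacity `F`: the supremum of the
achievable symmetric rates. -/
def IsSymCapacity (K n m : ℕ) (F : ℝ≥0∞) (C : ℝ) : Prop :=
  IsLUB {R : ℝ | SymAchievable K n m F R} C

/-- The piecewise rate. Its regimes are `m ≤ n/2`, `n/2 ≤ m ≤ 2n/3`, `2n/3 ≤ m < n`, `m = n`,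
`n < m ≤ 2n` and `2n ≤ m`; where two of them overlap, their expressions agree. -/
noncomputable def symRate (K n m : ℕ) (p : ℝ) : ℝ :=
  if 2 * m ≤ n then min ((n : ℝ) - m + p) ((n : ℝ) - m / 2)
  else if 3 * m ≤ 2 * n then min ((m : ℝ) + p) ((n : ℝ) - m / 2)
  else if m < n then (n : ℝ) - m / 2
  else if m = n then (n : ℝ) / K
  else if m ≤ 2 * n then (m : ℝ) / 2
  else min ((n : ℝ) + p) ((m : ℝ) / 2)

/-!
The channel is linear over `𝔽₂`, and since all cross gains are equal, a receiver sees the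
interferers only through the sum of their inputs. Hence a linear code that all users share works
for every number `K` of users as soon as a vanishing output forces the own message to vanish
(`symAchievable_of_linear`).

*Achievability.* For `n < m ≤ 2 n` and `2 n / 3 ≤ m < n` no feedback is needed: over two channel
uses there is a code on `m` levels whose words are independent of the words shifted by `|n - m|`
levels (`eq_zero_of_chainBit`). For equal gains the users take turns. In the other regimes the
sender adds `c` bits which without feedback could not be used: for `3 m ≤ 2 n` they spoil private
bits of the other users, and for `2 n ≤ m` they do not reach their own receiver. In both cases the
receiver feeds `c` bits back, from which its transmitter learns the sum `S` of these extra bits over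
all users. For `3 m ≤ 2 n` all transmitters then send `S`, which receivers use to remove the earlier
interference (`symAchievable_of_weak`). For `2 n ≤ m` they relay multiples of `S` such that the sum
of all multiples but one is always invertible; over `𝔽₂` this is impossible for odd `K`, so pairs of
channel uses are combined to work over `𝔽₄` (`symAchievable_of_veryStrong`). The two channel uses of
the scheme, respectively the two pairs of them, are why `2 p` is taken to be an integer.

*Converse.* As decoding never fails, all bounds come from counting. With unlimited feedback, if all
users but the second share one message, then the outputs of the first receiver together with those
levels of the second input that do not reach it determine everything
(`SymAchievable.two_mul_le`). For equal gains any receiver can recover all messages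
(`SymAchievable.le_div_of_eq`). Without feedback and with `m ≤ n`, the number of messages times the
number of interference patterns of one user is at most the number of interference patterns of
another user times `2 ^ (N max (m, n - m))`, and exchanging the two users removes the numbers of
patterns (`SymAchievable.le_max`). For `n ≤ m` the direct link carries only `n` bits
(`SymAchievable.le_direct`).
-/

/-! ### The channel in coordinates -/

/-- The bit of a vector at position `i`, read as `0` beyond the end of the vector. -/
def bitAt {q : ℕ} (i : ℕ) : (Fin q → ZMod 2) →+ ZMod 2 where
  toFun x := if h : i < q then x ⟨i, h⟩ else 0
  map_zero' := by simp
  map_add' x y := by by_cases h : i < q <;> simp [h]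

theorem bitAt_of_lt {q i : ℕ} (x : Fin q → ZMod 2) (h : i < q) : bitAt i x = x ⟨i, h⟩ := by
  simp [bitAt, h]

theorem bitAt_of_le {q i : ℕ} (x : Fin q → ZMod 2) (h : q ≤ i) : bitAt i x = 0 := by
  simp [bitAt, h]

theorem bitAt_coe {q : ℕ} (x : Fin q → ZMod 2) (i : Fin q) : bitAt (i : ℕ) x = x i :=
  bitAt_of_lt x i.isLt

theorem eq_of_bitAt_eq {q : ℕ} {x y : Fin q → ZMod 2} (h : ∀ i < q, bitAt i x = bitAt i y) :
    x = y := by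
  funext i
  rw [← bitAt_coe x, ← bitAt_coe y]
  exact h i i.isLt

theorem bitAt_shiftMatrix_mulVec (q i : ℕ) (hi : i < q) (x : LevelVec q) :
    bitAt i (shiftMatrix q *ᵥ x) = if 1 ≤ i then bitAt (i - 1) x else 0 := by
  rw [bitAt_of_lt _ hi]
  simp only [Matrix.mulVec, dotProduct, shiftMatrix, Matrix.of_apply, ite_mul, one_mul, zero_mul]
  split_ifs with h
  · have h1 : i - 1 < q := by omega
    rw [bitAt_of_lt _ h1, Finset.sum_eq_single (⟨i - 1, h1⟩ : Fin q)]
    · rw [if_pos (by simp; omega)]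
    · intro b _ hb
      rw [if_neg]
      intro h2
      apply hb
      ext
      simp
      omega
    · simp
  · apply Finset.sum_eq_zero
    intro b _
    rw [if_neg (by omega)]

theorem bitAt_shiftMatrix_pow_mulVec (q d i : ℕ) (hi : i < q) (x : LevelVec q) :
    bitAt i ((shiftMatrix q ^ d) *ᵥ x) = if d ≤ i then bitAt (i - d) x else 0 := by
  induction d generalizing i with
  | zero => simp
  | succ d ih =>
    rw [pow_succ', ← Matrix.mulVec_mulVec, bitAt_shiftMatrix_mulVec q i hi]
    by_cases h : 1 ≤ i
    · rw [if_pos h, ih (i - 1) (by omega)]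
      by_cases h2 : d + 1 ≤ i
      · rw [if_pos h2, if_pos (by omega), show i - 1 - d = i - (d + 1) by omega]
      · rw [if_neg h2, if_neg (by omega)]
    · rw [if_neg h, if_neg (by omega)]

/-- The contribution `D ^ (q - m) x` of an interfering input `x`. -/
def crossLink (n m : ℕ) (x : LevelVec (max n m)) : LevelVec (max n m) :=
  (shiftMatrix (max n m) ^ (max n m - m)) *ᵥ x

/-- The contribution `D ^ (q - n) x` of the intended input `x`. -/
def directLink (n m : ℕ) (x : LevelVec (max n m)) : LevelVec (max n m) :=
  (shiftMatrix (max n m) ^ (max n m - n)) *ᵥ x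

theorem detChannel_eq {K n m : ℕ} (X : Fin K → LevelVec (max n m)) (k : Fin K) :
    detChannel n m X k = directLink n m (X k) + ∑ j ∈ Finset.univ.erase k, crossLink n m (X j) :=
  rfl

theorem directLink_sub {n m : ℕ} (x y : LevelVec (max n m)) :
    directLink n m (x - y) = directLink n m x - directLink n m y :=
  Matrix.mulVec_sub _ _ _

theorem crossLink_sub {n m : ℕ} (x y : LevelVec (max n m)) :
    crossLink n m (x - y) = crossLink n m x - crossLink n m y :=
  Matrix.mulVec_sub _ _ _

theorem detChannel_sub {K n m : ℕ} (X X' : Fin K → LevelVec (max n m)) (k : Fin K) :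
    detChannel n m (fun j => X j - X' j) k = detChannel n m X k - detChannel n m X' k := by
  simp only [detChannel_eq, directLink_sub, crossLink_sub, Finset.sum_sub_distrib]
  abel

theorem bitAt_crossLink {n m i : ℕ} (hi : i < max n m) (x : LevelVec (max n m)) :
    bitAt i (crossLink n m x) = if n - m ≤ i then bitAt (i - (n - m)) x else 0 := by
  rw [crossLink, bitAt_shiftMatrix_pow_mulVec _ _ _ hi, show max n m - m = n - m by omega]

theorem bitAt_directLink {n m i : ℕ} (hi : i < max n m) (x : LevelVec (max n m)) :
    bitAt i (directLink n m x) = if m - n ≤ i then bitAt (i - (m - n)) x else 0 := by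
  rw [directLink, bitAt_shiftMatrix_pow_mulVec _ _ _ hi, show max n m - n = m - n by omega]

/-- Since every interferer has the same gain, receiver `k` only sees the interfering inputs
through their sum, level by level. -/
theorem bitAt_detChannel {K n m i : ℕ} (hi : i < max n m) (X : Fin K → LevelVec (max n m))
    (k : Fin K) :
    bitAt i (detChannel n m X k) =
      (if m - n ≤ i then bitAt (i - (m - n)) (X k) else 0) +
        if n - m ≤ i then bitAt (i - (n - m)) (∑ j ∈ Finset.univ.erase k, X j) else 0 := by
  rw [detChannel_eq, map_add, map_sum, bitAt_directLink hi]
  congr 1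
  simp only [bitAt_crossLink hi]
  split_ifs
  · rw [map_sum]
  · simp

/-! ### Inputs and outputs of a feedback code -/

namespace FeedbackCode

variable {K n m N : ℕ} (c : FeedbackCode K (max n m) N)

/-- The input of transmitter `k` at time `t` when the users send the messages `W`. -/
def input (W : Fin K → Fin c.M) (t : ℕ) (k : Fin K) : LevelVec (max n m) :=
  c.encode k t (W k) fun s => c.feedback k s fun r => c.output W r k

theorem output_eq (W : Fin K → Fin c.M) (t : ℕ) : c.output W t = detChannel n m (c.input W t) := by
  rw [FeedbackCode.output]
  rfl

theorem input_congr {W W' : Fin K → Fin c.M} {t : ℕ} {k : Fin K} (hW : W k = W' k)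
    (h : ∀ r < t, c.output W r k = c.output W' r k) : c.input W t k = c.input W' t k := by
  unfold input
  rw [hW]
  congr 1
  funext s
  congr 1
  funext r
  exact h r (by have := r.isLt; have := s.isLt; omega)

end FeedbackCode

theorem SymAchievable.mono {K n m : ℕ} {F F' : ℝ≥0∞} {R : ℝ} (h : SymAchievable K n m F R)
    (hF : F ≤ F') : SymAchievable K n m F' R := by
  obtain ⟨N, hN, c, h1, h2, h3⟩ := h
  exact ⟨N, hN, c, fun k => (h1 k).trans (by gcongr), h2, h3⟩

/-! ### Converse bounds -/

theorem mul_rate_le_of_card_le {M N a B : ℕ} {R : ℝ} (hN : 0 < N)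
    (hR : (2 : ℝ) ^ ((N : ℝ) * R) ≤ M) (h : M ^ a ≤ 2 ^ (N * B)) : (a : ℝ) * R ≤ B := by
  have h1 : (2 : ℝ) ^ ((N : ℝ) * ((a : ℝ) * R)) ≤ (2 : ℝ) ^ ((N : ℝ) * (B : ℝ)) := by
    calc (2 : ℝ) ^ ((N : ℝ) * ((a : ℝ) * R)) = ((2 : ℝ) ^ ((N : ℝ) * R)) ^ a := by
          rw [← Real.rpow_natCast, ← Real.rpow_mul (by norm_num)]
          congr 1
          ring
      _ ≤ (M : ℝ) ^ a := by gcongr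
      _ ≤ (2 : ℝ) ^ (N * B) := by exact_mod_cast h
      _ = (2 : ℝ) ^ ((N : ℝ) * (B : ℝ)) := by
          rw [← Real.rpow_natCast]
          push_cast
          rfl
  have h2 := (Real.rpow_le_rpow_left_iff (by norm_num : (1 : ℝ) < 2)).1 h1
  exact le_of_mul_le_mul_left h2 (by exact_mod_cast hN)

theorem card_pos_of_rate {M N : ℕ} {R : ℝ} (hR : (2 : ℝ) ^ ((N : ℝ) * R) ≤ M) : 0 < M := by
  have h : (0 : ℝ) < M := lt_of_lt_of_le (Real.rpow_pos_of_pos (by norm_num) _) hR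
  exact_mod_cast h

/-- With equal gains every receiver sees the sum of all inputs. -/
theorem detChannel_self {K n : ℕ} (X : Fin K → LevelVec (max n n)) (k : Fin K) :
    detChannel n n X k = ∑ j, X j := by
  simp only [detChannel, max_self, Nat.sub_self, pow_zero, Matrix.one_mulVec]
  exact Finset.add_sum_erase _ _ (Finset.mem_univ k)

/-- With equal gains all receivers see the same outputs, so that each of them can recover all `K`
messages from its `n` bits per channel use. -/
theorem SymAchievable.le_div_of_eq {K n : ℕ} (hK : 2 ≤ K) {F : ℝ≥0∞} {R : ℝ}
    (h : SymAchievable K n n F R) : R ≤ (n : ℝ) / K := by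
  obtain ⟨N, hN, c, -, hM, hdec⟩ := h
  let k₀ : Fin K := ⟨0, by omega⟩
  have hinj : Function.Injective
      fun (W : Fin K → Fin c.M) (t : Fin N) => c.output W t k₀ := by
    intro W W' h
    funext k
    rw [← hdec W k, ← hdec W' k]
    congr 1
    funext t
    have ht := congrFun h t
    simp only [FeedbackCode.output_eq, detChannel_self] at ht ⊢
    exact ht
  have hc := Fintype.card_le_of_injective _ hinj
  simp only [Fintype.card_pi, Fintype.card_fin, ZMod.card, Finset.prod_const, Finset.card_univ,
    max_self, ← pow_mul] at hc
  rw [Nat.mul_comm n N] at hc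
  have h2 := mul_rate_le_of_card_le hN hM hc
  rw [le_div_iff₀ (by positivity)]
  linarith

/-- An input is determined by its contribution at an unintended receiver and by its lowest
`n - m` levels, which do not reach that receiver. -/
theorem eq_of_crossLink_eq {n m : ℕ} {x y : LevelVec (max n m)}
    (h : crossLink n m x = crossLink n m y)
    (h' : ∀ i < n - m, bitAt (m + i) x = bitAt (m + i) y) : x = y := by
  apply eq_of_bitAt_eq
  intro i hi
  by_cases him : i < m
  · have h2 := congrArg (bitAt (i + (n - m))) h
    rw [bitAt_crossLink (by omega), bitAt_crossLink (by omega)] at h2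
    simpa using h2
  · have h2 := h' (i - m) (by omega)
    rwa [show m + (i - m) = i by omega] at h2

/-- Even with unlimited feedback, two users cannot exceed `max n m + (n - m)⁺` bits per channel
use in total: if all the other users repeat the message of the first one, then the outputs of the
first receiver and the lowest `n - m` levels of the inputs of the second transmitter determine, time
step after time step, everything that happens in the network. -/
theorem SymAchievable.two_mul_le {K n m : ℕ} (hK : 2 ≤ K) {F : ℝ≥0∞} {R : ℝ}
    (h : SymAchievable K n m F R) : 2 * R ≤ (max n m + (n - m) : ℕ) := by
  obtain ⟨N, hN, c, -, hM, hdec⟩ := h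
  let k₀ : Fin K := ⟨0, by omega⟩
  let k₁ : Fin K := ⟨1, by omega⟩
  have h01 : k₀ ≠ k₁ := by simp [k₀, k₁]
  let W : Fin c.M × Fin c.M → Fin K → Fin c.M := fun a j => if j = k₁ then a.2 else a.1
  have hinj : Function.Injective fun a : Fin c.M × Fin c.M =>
      ((fun t : Fin N => c.output (W a) t k₀,
        fun (t : Fin N) (i : Fin (n - m)) => bitAt (m + (i : ℕ)) (c.input (W a) t k₁)) :
        (Fin N → LevelVec (max n m)) × (Fin N → Fin (n - m) → ZMod 2)) := by
    intro a b hab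
    obtain ⟨hy, hx⟩ := Prod.mk.inj hab
    have h1 : a.1 = b.1 := by
      have ha := hdec (W a) k₀
      have hb := hdec (W b) k₀
      simp only [W, if_neg h01] at ha hb
      rw [← ha, ← hb]
      congr 1
    have hW : ∀ j, j ≠ k₁ → W a j = W b j := by
      intro j hj
      simp [W, hj, h1]
    have hout : ∀ t, t < N → c.output (W a) t = c.output (W b) t := by
      intro t
      induction t using Nat.strong_induction_on with
      | _ t ih =>
        intro ht
        have hj : ∀ j, j ≠ k₁ → c.input (W a) t j = c.input (W b) t j := fun j hj =>
          c.input_congr (hW j hj) fun r hr => by rw [ih r hr (by omega)]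
        have h2 : c.output (W a) t k₀ = c.output (W b) t k₀ := congrFun hy ⟨t, ht⟩
        have h3 : crossLink n m (c.input (W a) t k₁) = crossLink n m (c.input (W b) t k₁) := by
          have hmem : k₁ ∈ Finset.univ.erase k₀ := by simp [h01.symm]
          rw [c.output_eq, c.output_eq, detChannel_eq, detChannel_eq, hj k₀ h01,
            ← Finset.add_sum_erase _ _ hmem, ← Finset.add_sum_erase _ _ hmem] at h2
          have h4 : ∑ x ∈ (Finset.univ.erase k₀).erase k₁, crossLink n m (c.input (W a) t x) =
              ∑ x ∈ (Finset.univ.erase k₀).erase k₁, crossLink n m (c.input (W b) t x) :=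
            Finset.sum_congr rfl fun x hx => by rw [hj x (Finset.ne_of_mem_erase hx)]
          rw [h4] at h2
          exact add_right_cancel (add_left_cancel h2)
        have h5 : c.input (W a) t k₁ = c.input (W b) t k₁ :=
          eq_of_crossLink_eq h3 fun i hi => congrFun (congrFun hx ⟨t, ht⟩) ⟨i, hi⟩
        rw [c.output_eq, c.output_eq]
        congr 1
        funext j
        by_cases hjk : j = k₁
        · rw [hjk, h5]
        · exact hj j hjk
    have h2 : a.2 = b.2 := by
      have ha := hdec (W a) k₁
      have hb := hdec (W b) k₁
      simp only [W, if_true] at ha hb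
      rw [← ha, ← hb]
      congr 1
      funext t
      rw [hout t t.isLt]
    exact Prod.ext h1 h2
  have hc := Fintype.card_le_of_injective _ hinj
  simp only [Fintype.card_pi, Fintype.card_fin, ZMod.card, Finset.prod_const, Finset.card_univ,
    Fintype.card_prod, ← pow_mul, ← pow_add] at hc
  have h2 := mul_rate_le_of_card_le (a := 2) (B := max n m + (n - m)) hN hM
    (by rw [pow_two, mul_add, Nat.mul_comm N, Nat.mul_comm N]; exact hc)
  exact_mod_cast h2

/-- Without feedback, an input depends on nothing but the message of its own user. -/
theorem FeedbackCode.input_congr_of_noFeedback {K n m N : ℕ} (c : FeedbackCode K (max n m) N)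
    (hfb : ∀ k, ((∑ t ∈ Finset.range N, c.fbBits k t : ℕ) : ℝ≥0∞) ≤ N * 0)
    {W W' : Fin K → Fin c.M} {t : ℕ} (ht : t < N) {k : Fin K} (hW : W k = W' k) :
    c.input W t k = c.input W' t k := by
  have h0 : ∀ s < N, c.fbBits k s = 0 := by
    have h := hfb k
    rw [mul_zero, nonpos_iff_eq_zero, Nat.cast_eq_zero, Finset.sum_eq_zero_iff] at h
    intro s hs
    exact h s (Finset.mem_range.2 hs)
  unfold FeedbackCode.input
  rw [hW]
  congr 1
  funext s i
  have h1 := h0 s (by have := s.isLt; omega)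
  exact absurd i.isLt (by omega)

/-- Without feedback and with `n ≤ m`, the intended link carries at most `n` bits per channel
use. -/
theorem SymAchievable.le_direct {K n m : ℕ} (hK : 2 ≤ K) (hnm : n ≤ m) {R : ℝ}
    (h : SymAchievable K n m 0 R) : R ≤ n := by
  obtain ⟨N, hN, c, hfb, hM, hdec⟩ := h
  let k₀ : Fin K := ⟨0, by omega⟩
  let e : Fin c.M := ⟨0, card_pos_of_rate hM⟩
  let W : Fin c.M → Fin K → Fin c.M := fun a j => if j = k₀ then a else e
  have hinj : Function.Injective fun (a : Fin c.M) (t : Fin N) (i : Fin n) =>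
      bitAt (i : ℕ) (c.input (W a) t k₀) := by
    intro a b hab
    have ha := hdec (W a) k₀
    have hb := hdec (W b) k₀
    simp only [W, if_true] at ha hb
    rw [← ha, ← hb]
    congr 1
    funext t
    rw [c.output_eq, c.output_eq, detChannel_eq, detChannel_eq]
    congr 1
    · apply eq_of_bitAt_eq
      intro i hi
      rw [bitAt_directLink hi, bitAt_directLink hi]
      split_ifs with h
      · exact congrFun (congrFun hab t) ⟨i - (m - n), by omega⟩
      · rfl
    · refine Finset.sum_congr rfl fun j hj => ?_
      rw [c.input_congr_of_noFeedback hfb t.isLt (W' := W b)]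
      simp [W, Finset.ne_of_mem_erase hj]
  have hc := Fintype.card_le_of_injective _ hinj
  simp only [Fintype.card_pi, Fintype.card_fin, ZMod.card, Finset.prod_const, Finset.card_univ,
    ← pow_mul] at hc
  have h2 := mul_rate_le_of_card_le (a := 1) (B := n) hN hM
    (by rw [pow_one, Nat.mul_comm N]; exact hc)
  simpa using h2

/-- Without feedback and with `m ≤ n`, let `V j` be the set of the interference patterns that
transmitter `j` causes. Receiver `i` recovers the pair of its own message and of the pattern of
transmitter `j`. Its outputs on the levels below `min (n - m) m` are determined by the pattern of
its own transmitter, and `max m (n - m)` levels remain. -/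
theorem FeedbackCode.card_mul_card_le {K n m N : ℕ} (hmn : m ≤ n) (c : FeedbackCode K (max n m) N)
    (x : Fin K → Fin c.M → Fin N → LevelVec (max n m))
    (hx : ∀ W k (t : Fin N), c.input W t k = x k (W k) t)
    (hdec : ∀ (W : Fin K → Fin c.M) (k : Fin K), c.decode k (fun t => c.output W t k) = W k)
    {i j : Fin K} (hij : i ≠ j) :
    c.M * Nat.card (Set.range fun a t => crossLink n m (x j a t)) ≤
      Nat.card (Set.range fun a t => crossLink n m (x i a t)) * 2 ^ (N * max m (n - m)) := by
  classical
  rcases Nat.eq_zero_or_pos c.M with h0 | h0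
  · simp [h0]
  let e : Fin c.M := ⟨0, h0⟩
  let W : Fin c.M → Fin c.M → Fin K → Fin c.M :=
    fun a b k => if k = i then a else if k = j then b else e
  have hWi : ∀ a b, W a b i = a := fun a b => by simp [W]
  have hWj : ∀ a b, W a b j = b := fun a b => by simp [W, hij.symm]
  have hout : ∀ a b (t : Fin N), c.output (W a b) t i = directLink n m (x i a t) +
      (crossLink n m (x j b t) +
        ∑ k ∈ (Finset.univ.erase i).erase j, crossLink n m (x k e t)) := by
    intro a b t
    have hmem : j ∈ Finset.univ.erase i := by simp [hij.symm]
    rw [c.output_eq, detChannel_eq, ← Finset.add_sum_erase _ _ hmem, hx, hx, hWi, hWj]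
    congr 2
    refine Finset.sum_congr rfl fun k hk => ?_
    simp only [Finset.mem_erase] at hk
    rw [hx]
    simp [W, hk.1, hk.2.1]
  -- a message of user `j` that causes a given pattern
  let b : (Set.range fun a t => crossLink n m (x j a t)) → Fin c.M := fun v => v.2.choose
  have hb : ∀ v t, crossLink n m (x j (b v) t) = v.1 t := fun v t => congrFun v.2.choose_spec t
  let f : Fin c.M × (Set.range fun a t => crossLink n m (x j a t)) →
      (Set.range fun a t => crossLink n m (x i a t)) × (Fin N → Fin (max m (n - m)) → ZMod 2) :=
    fun p => (⟨fun t => crossLink n m (x i p.1 t), p.1, rfl⟩,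
      fun t l => bitAt (min (n - m) m + (l : ℕ)) (c.output (W p.1 (b p.2)) t i))
  have hf : Function.Injective f := by
    rintro ⟨a, v⟩ ⟨a', v'⟩ h
    obtain ⟨h1, h2⟩ := Prod.mk.inj h
    have h1' : ∀ t, crossLink n m (x i a t) = crossLink n m (x i a' t) :=
      fun t => congrFun (congrArg Subtype.val h1) t
    have hy : ∀ t : Fin N, c.output (W a (b v)) t i = c.output (W a' (b v')) t i := by
      intro t
      apply eq_of_bitAt_eq
      intro l hl
      by_cases hl2 : l < min (n - m) m
      · have hz : ∀ z : LevelVec (max n m), bitAt l (crossLink n m z) = 0 := fun z => by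
          rw [bitAt_crossLink hl, if_neg (by omega)]
        rw [hout, hout]
        simp only [map_add, map_sum, hz, Finset.sum_const_zero, add_zero]
        have h3 := congrArg (bitAt (l + (n - m))) (h1' t)
        rw [bitAt_crossLink (by omega), bitAt_crossLink (by omega)] at h3
        rw [bitAt_directLink hl, bitAt_directLink hl]
        simp only [show m - n = 0 by omega]
        simpa using h3
      · have h3 := congrFun (congrFun h2 t) ⟨l - min (n - m) m, by omega⟩
        simpa only [show min (n - m) m + (l - min (n - m) m) = l by omega] using h3
    have ha : a = a' := by
      have ha := hdec (W a (b v)) i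
      have hb := hdec (W a' (b v')) i
      rw [hWi] at ha hb
      rw [← ha, ← hb]
      congr 1
      funext t
      exact hy t
    subst ha
    have hv : v = v' := by
      apply Subtype.ext
      funext t
      have h3 := hy t
      rw [hout, hout, hb, hb] at h3
      exact add_right_cancel (add_left_cancel h3)
    rw [hv]
  have hc := Nat.card_le_card_of_injective f hf
  simpa [Nat.card_prod, ← pow_mul, Nat.mul_comm _ N] using hc

/-- Without feedback and with `m ≤ n`, the rate is at most `max m (n - m)`: in
`FeedbackCode.card_mul_card_le` for two users and for the same users exchanged, the numbers of
interference patterns cancel. -/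
theorem SymAchievable.le_max {K n m : ℕ} (hK : 2 ≤ K) (hmn : m ≤ n) {R : ℝ}
    (h : SymAchievable K n m 0 R) : R ≤ (max m (n - m) : ℕ) := by
  obtain ⟨N, hN, c, hfb, hM, hdec⟩ := h
  let k₀ : Fin K := ⟨0, by omega⟩
  let k₁ : Fin K := ⟨1, by omega⟩
  have h01 : k₀ ≠ k₁ := by simp [k₀, k₁]
  have hpos := card_pos_of_rate hM
  let x : Fin K → Fin c.M → Fin N → LevelVec (max n m) := fun k a t => c.input (fun _ => a) t k
  have hx : ∀ W k (t : Fin N), c.input W t k = x k (W k) t :=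
    fun W k t => c.input_congr_of_noFeedback hfb t.isLt rfl
  have h1 := c.card_mul_card_le hmn x hx hdec h01
  have h2 := c.card_mul_card_le hmn x hx hdec h01.symm
  have hp : ∀ k, 0 < Nat.card (Set.range fun a t => crossLink n m (x k a t)) := fun k =>
    Nat.card_pos_iff.2 ⟨⟨_, ⟨0, hpos⟩, rfl⟩, inferInstance⟩
  have hp0 := hp k₀
  have hp1 := hp k₁
  generalize Nat.card (Set.range fun a t => crossLink n m (x k₀ a t)) = v₀ at *
  generalize Nat.card (Set.range fun a t => crossLink n m (x k₁ a t)) = v₁ at *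
  have h3 : c.M ≤ 2 ^ (N * max m (n - m)) := by
    by_contra hlt
    push Not at hlt
    rcases le_total v₀ v₁ with hv | hv
    · have : v₀ * 2 ^ (N * max m (n - m)) < c.M * v₁ := by
        calc _ < v₀ * c.M := by gcongr
          _ ≤ v₁ * c.M := by gcongr
          _ = _ := Nat.mul_comm _ _
      omega
    · have : v₁ * 2 ^ (N * max m (n - m)) < c.M * v₀ := by
        calc _ < v₁ * c.M := by gcongr
          _ ≤ v₀ * c.M := by gcongr
          _ = _ := Nat.mul_comm _ _
      omega
  have h4 := mul_rate_le_of_card_le (a := 1) (B := max m (n - m)) hN hM (by rw [pow_one]; exact h3)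
  simpa using h4

/-! ### Linear two-phase schemes -/

/-- A code with one burst of feedback bits, indexed by `B`, between a first phase of `N₁` and a
second phase of `N₂` channel uses achieves its rate as soon as the outputs of each receiver in the
two phases determine its message. -/
theorem symAchievable_of_twoPhase {K n m N₁ N₂ : ℕ} {A B : Type} [Fintype A] [Nonempty A]
    [Fintype B]
    (hN : 0 < N₁ + N₂) {F : ℝ≥0∞} {R : ℝ} (hF : (Fintype.card B : ℝ≥0∞) ≤ (N₁ + N₂ : ℕ) * F)
    (hR : (2 : ℝ) ^ (((N₁ + N₂ : ℕ) : ℝ) * R) ≤ Fintype.card A)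
    (enc₁ : Fin K → A → Fin N₁ → LevelVec (max n m))
    (fb : (Fin N₁ → LevelVec (max n m)) → B → ZMod 2)
    (enc₂ : Fin K → A → (B → ZMod 2) → Fin N₂ → LevelVec (max n m))
    (y₁ : (Fin K → A) → Fin K → Fin N₁ → LevelVec (max n m))
    (y₂ : (Fin K → A) → Fin K → Fin N₂ → LevelVec (max n m))
    (hy₁ : ∀ w k s, y₁ w k s = detChannel n m (fun j => enc₁ j (w j) s) k)
    (hy₂ : ∀ w k s, y₂ w k s = detChannel n m (fun j => enc₂ j (w j) (fb (y₁ w j)) s) k)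
    (hdec : ∀ w w' k, y₁ w k = y₁ w' k → y₂ w k = y₂ w' k → w k = w' k) :
    SymAchievable K n m F R := by
  have hd : ∀ k, ∃ d : (Fin N₁ → LevelVec (max n m)) × (Fin N₂ → LevelVec (max n m)) → A,
      ∀ w, d (y₁ w k, y₂ w k) = w k := fun k =>
    ⟨Function.extend (fun w => (y₁ w k, y₂ w k)) (fun w => w k) fun _ => Classical.arbitrary A,
      fun w => Function.FactorsThrough.extend_apply (f := fun w => (y₁ w k, y₂ w k))
        (g := fun w : Fin K → A => w k)
        (fun w w' h => hdec w w' k (Prod.mk.inj h).1 (Prod.mk.inj h).2) _ w⟩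
  choose d hd using hd
  let e := Fintype.equivFin A
  let eB := Fintype.equivFin B
  -- The burst is sent at time `N₁`, when all first-phase outputs are known, and it reaches the
  -- transmitter before the input of that time.
  let code : FeedbackCode K (max n m) (N₁ + N₂) :=
    { M := Fintype.card A
      fbBits := fun _ t => if t = N₁ then Fintype.card B else 0
      feedback := fun _ t y i =>
        bitAt (i : ℕ) fun l => fb (fun r => if h : (r : ℕ) < t then y ⟨r, h⟩ else 0) (eB.symm l)
      encode := fun k t a z =>
        if h : t < N₁ then enc₁ k (e.symm a) ⟨t, h⟩
        else if h' : t - N₁ < N₂ then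
          enc₂ k (e.symm a) (fun b => bitAt (eB b : ℕ) (z ⟨N₁, by omega⟩)) ⟨t - N₁, h'⟩
        else 0
      decode := fun k y => e (d k (fun s => y (Fin.castAdd N₂ s), fun s => y (Fin.natAdd N₁ s))) }
  have ho₁ : ∀ (W : Fin K → Fin code.M) k (s : Fin N₁),
      code.output W s k = y₁ (fun j => e.symm (W j)) k s := by
    intro W k s
    rw [code.output_eq, hy₁]
    congr 1
    funext j
    simp only [FeedbackCode.input, code, dif_pos s.isLt]
  have ho₂ : ∀ (W : Fin K → Fin code.M) k (s : Fin N₂),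
      code.output W (N₁ + (s : ℕ)) k = y₂ (fun j => e.symm (W j)) k s := by
    intro W k s
    rw [code.output_eq, hy₂]
    congr 1
    funext j
    have h1 : ¬ N₁ + (s : ℕ) < N₁ := by omega
    have h2 : N₁ + (s : ℕ) - N₁ = s := by omega
    have h3 : N₁ + (s : ℕ) - N₁ < N₂ := by omega
    have h4 : (fun r : Fin N₁ => code.output W r j) = y₁ (fun j => e.symm (W j)) j :=
      funext fun r => ho₁ W j r
    have h5 : code.input W (N₁ + s) j = enc₂ j (e.symm (W j))
        (fun b => bitAt (eB b : ℕ) (code.feedback j N₁ fun r => code.output W r j))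
        ⟨N₁ + (s : ℕ) - N₁, h3⟩ := by
      simp only [FeedbackCode.input]
      simp only [code, dif_neg h1, dif_pos h3]
    rw [h5]
    congr 1
    · funext b
      have hb : (eB b : ℕ) < code.fbBits j N₁ := by simp [code]
      rw [bitAt_of_lt _ hb]
      simp only [code]
      rw [bitAt_coe, eB.symm_apply_apply]
      congr 1
      rw [← h4]
      funext r
      rw [dif_pos r.isLt]
    · simp
  refine ⟨N₁ + N₂, hN, code, fun k => ?_, hR, fun W k => ?_⟩
  · refine le_trans ?_ hF
    simp only [code, Finset.sum_ite_eq']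
    split_ifs <;> simp
  · have h := hd k fun j => e.symm (W j)
    have h1 : code.decode k (fun t => code.output W t k) = e (d k
        (fun s : Fin N₁ => code.output W s k, fun s : Fin N₂ => code.output W (N₁ + (s : ℕ)) k)) :=
      rfl
    rw [h1, show (fun s : Fin N₁ => code.output W s k) = _ from funext (ho₁ W k),
      show (fun s : Fin N₂ => code.output W (N₁ + (s : ℕ)) k) = _ from funext (ho₂ W k), h]
    exact e.apply_symm_apply _

/-- Linear two-phase schemes. Each receiver feeds the linear function `f` of its first-phase
outputs back, that is `f` of its own input plus the sum of the parts `σ` of the interfering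
messages. Its transmitter knows the former and its own `σ`, hence it learns the sum of the `σ` of
all users, and it adds a linear function `G` of this sum to its input in the second phase. Such a
scheme succeeds if a vanishing output at receiver `k` forces the message of user `k` to vanish. -/
theorem symAchievable_of_linear {K n m N₁ N₂ : ℕ} {A B : Type} [AddCommGroup A] [Fintype A]
    [Fintype B]
    (hN : 0 < N₁ + N₂) {F : ℝ≥0∞} {R : ℝ} (hF : (Fintype.card B : ℝ≥0∞) ≤ (N₁ + N₂ : ℕ) * F)
    (hR : (2 : ℝ) ^ (((N₁ + N₂ : ℕ) : ℝ) * R) ≤ Fintype.card A)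
    (E₁ : Fin K → A →+ (Fin N₁ → LevelVec (max n m)))
    (f : (Fin N₁ → LevelVec (max n m)) →+ (B → ZMod 2))
    (σ : A →+ (B → ZMod 2))
    (hσ : ∀ k a, f (fun s => crossLink n m (E₁ k a s)) = σ a)
    (E₂ : A →+ (Fin N₂ → LevelVec (max n m)))
    (G : Fin K → (B → ZMod 2) →+ (Fin N₂ → LevelVec (max n m)))
    (hker : ∀ (w : Fin K → A) k, (∀ s, detChannel n m (fun j => E₁ j (w j) s) k = 0) →
      (∀ s, detChannel n m (fun j => E₂ (w j) s + G j (∑ i, σ (w i)) s) k = 0) → w k = 0) :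
    SymAchievable K n m F R := by
  let y₁ : (Fin K → A) → Fin K → Fin N₁ → LevelVec (max n m) :=
    fun w k s => detChannel n m (fun j => E₁ j (w j) s) k
  let y₂ : (Fin K → A) → Fin K → Fin N₂ → LevelVec (max n m) :=
    fun w k s => detChannel n m (fun j => E₂ (w j) s + G j (∑ i, σ (w i)) s) k
  have hf : ∀ w k, f (y₁ w k) =
      f (fun s => directLink n m (E₁ k (w k) s)) + ∑ j ∈ Finset.univ.erase k, σ (w j) := by
    intro w k
    have h1 : y₁ w k = (fun s => directLink n m (E₁ k (w k) s)) +
        ∑ j ∈ Finset.univ.erase k, fun s => crossLink n m (E₁ j (w j) s) := by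
      funext s
      simp only [Pi.add_apply, Finset.sum_apply]
      exact detChannel_eq _ _
    rw [h1, map_add, map_sum]
    simp only [hσ]
  refine symAchievable_of_twoPhase hN hF hR (fun k a => E₁ k a) f
    (fun k a z s => E₂ a s + G k (z - f (fun s => directLink n m (E₁ k a s)) + σ a) s)
    y₁ y₂ (fun _ _ _ => rfl) (fun w k s => ?_) (fun w w' k h₁ h₂ => ?_)
  · have h : ∀ j, f (y₁ w j) - f (fun s => directLink n m (E₁ j (w j) s)) + σ (w j) =
        ∑ i, σ (w i) := by
      intro j
      rw [hf, add_sub_cancel_left, Finset.sum_erase_add _ _ (Finset.mem_univ j)]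
    simp only [h]
    rfl
  · rw [← sub_eq_zero]
    refine hker (fun j => w j - w' j) k (fun s => ?_) (fun s => ?_)
    · simp only [map_sub, Pi.sub_apply, detChannel_sub]
      exact sub_eq_zero.2 (congrFun h₁ s)
    · have h : ∀ j, E₂ (w j - w' j) s + G j (∑ i, σ (w i - w' i)) s =
          (E₂ (w j) s + G j (∑ i, σ (w i)) s) - (E₂ (w' j) s + G j (∑ i, σ (w' i)) s) := by
        intro j
        simp only [map_sub, Finset.sum_sub_distrib, Pi.sub_apply]
        abel
      simp only [h, detChannel_sub]
      exact sub_eq_zero.2 (congrFun h₂ s)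

/-- Linear schemes without feedback. -/
theorem symAchievable_of_linear_noFeedback {K n m N : ℕ} {A : Type} [AddCommGroup A] [Fintype A]
    (hN : 0 < N) {R : ℝ} (hR : (2 : ℝ) ^ ((N : ℝ) * R) ≤ Fintype.card A)
    (E : Fin K → A →+ (Fin N → LevelVec (max n m)))
    (hker : ∀ (w : Fin K → A) k, (∀ s, detChannel n m (fun j => E j (w j) s) k = 0) → w k = 0)
    (F : ℝ≥0∞) :
    SymAchievable K n m F R :=
  symAchievable_of_linear (N₂ := 0) (B := Fin 0) hN (by simp) hR E 0 0 (fun _ _ => rfl) 0 0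
    fun w k h _ => hker w k h

/-! ### A code without feedback on chains of levels -/

/-- The bit sent at level `i` in slot `s` of a code of two slots that carries one bit for each of
`m` levels. The levels are divided into chains of step `δ`, so that `i / δ` is the place of level
`i` in its chain. Consecutive places `2 r` and `2 r + 1` are paired, the two bits of a pair being
sent at its upper level, one in each slot. In a chain of odd length the last bit is sent at the
last level but one in the first slot, and at the last level in the second slot. -/
def chainBit (m δ : ℕ) (s : Fin 2) (i : ℕ) : (Fin m → ZMod 2) →+ ZMod 2 where
  toFun x :=
    if s = 0 then
      if Even (i / δ) then if i + δ < m then bitAt i x else 0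
      else if m ≤ i + 2 * δ then bitAt (i + δ) x else 0
    else
      if Even (i / δ) then if i + δ < m then bitAt (i + δ) x else bitAt i x
      else 0
  map_zero' := by split_ifs <;> simp
  map_add' x y := by split_ifs <;> simp

section chainBit

variable {m δ i : ℕ} (x : Fin m → ZMod 2)

theorem chainBit_zero_of_pair (h : Even (i / δ)) (h' : i + δ < m) :
    chainBit m δ 0 i x = bitAt i x := by
  simp [chainBit, h, h']

theorem chainBit_one_of_pair (h : Even (i / δ)) (h' : i + δ < m) :
    chainBit m δ 1 i x = bitAt (i + δ) x := by
  simp [chainBit, h, h']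

theorem chainBit_zero_of_last (h : Even (i / δ)) (h' : m ≤ i + δ) :
    chainBit m δ 0 i x = 0 := by
  simp [chainBit, h, h'.not_gt]

theorem chainBit_one_of_last (h : Even (i / δ)) (h' : m ≤ i + δ) :
    chainBit m δ 1 i x = bitAt i x := by
  simp [chainBit, h, h'.not_gt]

theorem chainBit_zero_of_odd (h : ¬ Even (i / δ)) :
    chainBit m δ 0 i x = if m ≤ i + 2 * δ then bitAt (i + δ) x else 0 := by
  simp [chainBit, h]

theorem chainBit_one_of_odd (h : ¬ Even (i / δ)) : chainBit m δ 1 i x = 0 := by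
  simp [chainBit, h]

end chainBit

/-- The words of the chain code and their shifts by `δ` levels are independent: neither a word nor
the shift of a word can hide the other one. -/
theorem eq_zero_of_chainBit {m δ : ℕ} (hδ : 0 < δ) (hm : 2 * δ ≤ m) (a b : Fin m → ZMod 2)
    (h : ∀ s, ∀ i < m, chainBit m δ s i a + (if δ ≤ i then chainBit m δ s (i - δ) b else 0) = 0) :
    a = 0 ∧ b = 0 := by
  have hodd : ∀ i, Even ((i + δ) / δ) ↔ ¬ Even (i / δ) := fun i => by
    rw [Nat.add_div_right _ hδ, Nat.even_add_one]
  have hodd' : ∀ i, δ ≤ i → (Even ((i - δ) / δ) ↔ ¬ Even (i / δ)) := fun i hi => by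
    have := hodd (i - δ)
    rw [Nat.sub_add_cancel hi] at this
    tauto
  -- At the upper level of a pair no interference arrives.
  have hpair : ∀ i, Even (i / δ) → i + δ < m → bitAt i a = 0 ∧ bitAt (i + δ) a = 0 := by
    intro i he hi
    have h0 := h 0 i (by omega)
    have h1 := h 1 i (by omega)
    rw [chainBit_zero_of_pair a he hi] at h0
    rw [chainBit_one_of_pair a he hi] at h1
    by_cases hδi : δ ≤ i
    · have ho : ¬ Even ((i - δ) / δ) := by rw [hodd' i hδi]; simpa using he
      rw [if_pos hδi, chainBit_zero_of_odd b ho, if_neg (by omega), add_zero] at h0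
      rw [if_pos hδi, chainBit_one_of_odd b ho, add_zero] at h1
      exact ⟨h0, h1⟩
    · rw [if_neg hδi, add_zero] at h0 h1
      exact ⟨h0, h1⟩
  have hlast : ∀ i < m, Even (i / δ) → m ≤ i + δ → bitAt i a = 0 ∧ bitAt i b = 0 := by
    intro i him he hi
    have hδi : δ ≤ i := by omega
    have ho : ¬ Even ((i - δ) / δ) := by rw [hodd' i hδi]; simpa using he
    have h0 := h 0 i him
    have h1 := h 1 i him
    rw [chainBit_zero_of_last a he hi, if_pos hδi, chainBit_zero_of_odd b ho, if_pos (by omega),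
      zero_add, Nat.sub_add_cancel hδi] at h0
    rw [chainBit_one_of_last a he hi, if_pos hδi, chainBit_one_of_odd b ho, add_zero] at h1
    exact ⟨h1, h0⟩
  -- At the lower level of a pair the word vanishes, but for the copy of a last bit.
  have hpair' : ∀ i, Even (i / δ) → i + δ < m → bitAt i b = 0 ∧ bitAt (i + δ) b = 0 := by
    intro i he hi
    have ho : ¬ Even ((i + δ) / δ) := by rw [hodd]; simpa using he
    have h0 := h 0 (i + δ) hi
    have h1 := h 1 (i + δ) hi
    have hz : (if m ≤ i + δ + 2 * δ then bitAt (i + δ + δ) a else 0) = 0 := by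
      split_ifs with h3
      · by_cases h4 : i + δ + δ < m
        · have he2 : Even ((i + δ + δ) / δ) := by rw [hodd]; exact ho
          exact (hlast _ h4 he2 (by omega)).1
        · exact bitAt_of_le _ (by omega)
      · rfl
    rw [chainBit_zero_of_odd a ho, hz, if_pos (by omega), Nat.add_sub_cancel,
      chainBit_zero_of_pair b he hi, zero_add] at h0
    rw [chainBit_one_of_odd a ho, if_pos (by omega), Nat.add_sub_cancel,
      chainBit_one_of_pair b he hi, zero_add] at h1
    exact ⟨h0, h1⟩
  have hall : ∀ i < m, bitAt i a = 0 ∧ bitAt i b = 0 := by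
    intro i hi
    by_cases he : Even (i / δ)
    · by_cases hi2 : i + δ < m
      · exact ⟨(hpair i he hi2).1, (hpair' i he hi2).1⟩
      · exact hlast i hi he (by omega)
    · have hδi : δ ≤ i := by
        by_contra hlt
        exact he (by rw [Nat.div_eq_of_lt (by omega)]; exact Even.zero)
      have he2 := (hodd' i hδi).2 he
      have h1 := hpair (i - δ) he2 (by omega)
      have h2 := hpair' (i - δ) he2 (by omega)
      rw [Nat.sub_add_cancel hδi] at h1 h2
      exact ⟨h1.2, h2.2⟩
  exact ⟨eq_of_bitAt_eq fun i hi => by rw [(hall i hi).1, map_zero],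
    eq_of_bitAt_eq fun i hi => by rw [(hall i hi).2, map_zero]⟩

/-! ### The schemes -/

theorem rpow_le_card {A : Type} [Fintype A] {d : ℕ} {x : ℝ} (hA : Fintype.card A = 2 ^ d)
    (hx : x ≤ d) : (2 : ℝ) ^ x ≤ Fintype.card A := by
  rw [hA, Nat.cast_pow, Nat.cast_ofNat, ← Real.rpow_natCast]
  exact Real.rpow_le_rpow_of_exponent_le (by norm_num) hx

/-- With equal gains the users take turns. -/
theorem symAchievable_of_eq {K n : ℕ} (hK : 2 ≤ K) (F : ℝ≥0∞) :
    SymAchievable K n n F ((n : ℝ) / K) := by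
  refine symAchievable_of_linear_noFeedback (N := K) (A := LevelVec (max n n)) (by omega)
    (rpow_le_card (d := n) (by simp) ?_)
    (fun k => AddMonoidHom.mk' (fun a s => if s = k then a else 0) fun a b => ?_) ?_ F
  · have : (K : ℝ) ≠ 0 := by positivity
    rw [mul_div_cancel₀ _ this]
  · funext s
    by_cases h : s = k <;> simp [h]
  · intro w k h
    have h1 := h k
    rw [detChannel_self] at h1
    simpa using h1

/-- The chain code for `n < m ≤ 2 n`. -/
theorem symAchievable_of_strong {K n m : ℕ} (h₁ : n < m) (h₂ : m ≤ 2 * n) (F : ℝ≥0∞) :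
    SymAchievable K n m F ((m : ℝ) / 2) := by
  refine symAchievable_of_linear_noFeedback (N := 2) (A := Fin m → ZMod 2) (by omega)
    (rpow_le_card (d := m) (by simp) ?_)
    (fun _ => AddMonoidHom.mk' (fun a s i => chainBit m (m - n) s i a) fun a b => ?_) ?_ F
  · push_cast
    linarith
  · funext s i
    simp
  · intro w k h
    refine (eq_zero_of_chainBit (m := m) (δ := m - n) (by omega) (by omega)
      (∑ j ∈ Finset.univ.erase k, w j) (w k) fun s i hi => ?_).2
    have h1 := congrArg (bitAt i) (h s)
    have hi' : i < max n m := by omega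
    have hi2 : i - (m - n) < max n m := by omega
    rw [bitAt_detChannel hi', map_zero, map_sum] at h1
    simp only [show n - m = 0 by omega, Nat.zero_le, if_true, Nat.sub_zero,
      bitAt_of_lt _ hi', bitAt_of_lt _ hi2, AddMonoidHom.mk'_apply] at h1
    rw [map_sum, add_comm]
    exact h1

/-- For `2 n / 3 ≤ m < n` the top `m` levels carry the chain code. The lowest `n - m` levels, which
no other receiver sees, carry private bits; they are read off after the interference has been
found from the levels above. -/
theorem symAchievable_of_moderate {K n m : ℕ} (h₁ : 2 * n ≤ 3 * m) (h₂ : m < n) (F : ℝ≥0∞) :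
    SymAchievable K n m F ((n : ℝ) - m / 2) := by
  refine symAchievable_of_linear_noFeedback (N := 2)
    (A := (Fin m → ZMod 2) × (Fin 2 → Fin (n - m) → ZMod 2)) (by omega)
    (rpow_le_card (d := m + 2 * (n - m)) ?_ ?_)
    (fun _ => AddMonoidHom.mk' (fun a s i => if (i : ℕ) < m then chainBit m (n - m) s i a.1
      else bitAt ((i : ℕ) - m) (a.2 s)) fun a b => ?_) ?_ F
  · simp [pow_add, ← pow_mul, Nat.mul_comm]
  · push_cast [Nat.cast_sub h₂.le]
    linarith
  · funext s i
    by_cases h : (i : ℕ) < m <;> simp [h]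
  · intro w k h
    have key : ∀ s, ∀ i < n, (if i < m then chainBit m (n - m) s i (w k).1
        else bitAt (i - m) ((w k).2 s)) + (if n - m ≤ i then
          chainBit m (n - m) s (i - (n - m)) (∑ j ∈ Finset.univ.erase k, (w j).1) else 0) = 0 := by
      intro s i hi
      have h1 := congrArg (bitAt i) (h s)
      have hi' : i < max n m := by omega
      have hi2 : i - (n - m) < max n m := by omega
      have hi3 : i - (n - m) < m := by omega
      rw [bitAt_detChannel hi', map_zero, map_sum] at h1
      simp only [show m - n = 0 by omega, Nat.zero_le, if_true, Nat.sub_zero,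
        bitAt_of_lt _ hi', bitAt_of_lt _ hi2, AddMonoidHom.mk'_apply, if_pos hi3] at h1
      rw [map_sum]
      exact h1
    have hz := eq_zero_of_chainBit (m := m) (δ := n - m) (by omega) (by omega) (w k).1
      (∑ j ∈ Finset.univ.erase k, (w j).1) fun s i hi => by
        have h1 := key s i (by omega)
        rwa [if_pos hi] at h1
    refine Prod.ext hz.1 ?_
    funext s
    refine eq_of_bitAt_eq fun i hi => ?_
    have h1 := key s (m + i) (by omega)
    rw [hz.2, if_neg (by omega), Nat.add_sub_cancel_left] at h1
    simpa using h1

/-- Three blocks of bits placed on a vector from the levels `0`, `ℓ` and `p` on. -/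
def layered (q ℓ p : ℕ) {c d : ℕ} :
    (Fin ℓ → ZMod 2) × (Fin c → ZMod 2) × (Fin d → ZMod 2) →+ LevelVec q :=
  AddMonoidHom.mk' (fun a i => bitAt (i : ℕ) a.1 +
      (if ℓ ≤ (i : ℕ) then bitAt ((i : ℕ) - ℓ) a.2.1 else 0) +
      if p ≤ (i : ℕ) then bitAt ((i : ℕ) - p) a.2.2 else 0) fun a b => by
    funext i
    simp only [Prod.fst_add, Prod.snd_add, map_add, Pi.add_apply]
    split_ifs <;> abel

theorem bitAt_layered {q ℓ p c d i : ℕ} (hi : i < q)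
    (a : (Fin ℓ → ZMod 2) × (Fin c → ZMod 2) × (Fin d → ZMod 2)) :
    bitAt i (layered q ℓ p a) = bitAt i a.1 + (if ℓ ≤ i then bitAt (i - ℓ) a.2.1 else 0) +
      if p ≤ i then bitAt (i - p) a.2.2 else 0 := by
  rw [bitAt_of_lt _ hi]
  rfl

/-- Decoding for `3 m ≤ 2 n`. The first and the second block arrive above the interference; the
interference of the second block only hits the third block, which itself is not seen by the other
receivers. -/
theorem layered_eq_zero_of_weak {K n m c : ℕ} (h : 3 * m ≤ 2 * n)
    (hc : m - (n - m) + c ≤ min (n - m) m)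
    (X : Fin K → (Fin (m - (n - m)) → ZMod 2) × (Fin c → ZMod 2) × (Fin (n - m) → ZMod 2))
    (k : Fin K)
    (h0 : detChannel n m (fun j => layered (max n m) (m - (n - m)) m (X j)) k = 0) :
    (X k).1 = 0 ∧ (X k).2.1 = 0 ∧
      (∑ j ∈ Finset.univ.erase k, (X j).2.1 = 0 → (X k).2.2 = 0) := by
  rw [show ∑ j ∈ Finset.univ.erase k, (X j).2.1 = (∑ j ∈ Finset.univ.erase k, X j).2.1 by
    rw [Prod.snd_sum, Prod.fst_sum]]
  have key : ∀ i < n, bitAt i (layered (max n m) (m - (n - m)) m (X k)) + (if n - m ≤ i then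
      bitAt (i - (n - m)) (layered (max n m) (m - (n - m)) m (∑ j ∈ Finset.univ.erase k, X j))
      else 0) = 0 := by
    intro i hi
    have h1 := congrArg (bitAt i) h0
    rw [bitAt_detChannel (by omega), map_zero, ← map_sum] at h1
    simpa only [show m - n = 0 by omega, Nat.zero_le, if_true, Nat.sub_zero] using h1
  generalize ∑ j ∈ Finset.univ.erase k, X j = Y at *
  have hu : (X k).1 = 0 := by
    refine eq_of_bitAt_eq fun i hi => ?_
    have h1 := key i (by omega)
    rw [bitAt_layered (by omega), if_neg (by omega), if_neg (by omega), if_neg (by omega)] at h1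
    simpa using h1
  have ha : (X k).2.1 = 0 := by
    refine eq_of_bitAt_eq fun i hi => ?_
    have h1 := key (m - (n - m) + i) (by omega)
    rw [bitAt_layered (by omega), if_pos (by omega), if_neg (by omega), if_neg (by omega), hu,
      Nat.add_sub_cancel_left] at h1
    simpa using h1
  refine ⟨hu, ha, fun hY => ?_⟩
  refine eq_of_bitAt_eq fun i hi => ?_
  have h1 := key (m + i) (by omega)
  rw [bitAt_layered (by omega), hu, ha, if_pos (by omega), if_pos (by omega),
    Nat.add_sub_cancel_left] at h1
  by_cases h2 : n - m ≤ m + i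
  · rw [if_pos h2, bitAt_layered (by omega), hY, bitAt_of_le Y.1 (by omega), if_pos (by omega),
      if_neg (by omega)] at h1
    simpa using h1
  · rw [if_neg h2] at h1
    simpa using h1

/-- The scheme for `3 m ≤ 2 n`, with `c` feedback bits in two channel uses. In the first use `c`
levels carry bits whose interference spoils `c` private bits of the other users. The feedback tells
every transmitter the sum of these bits, and all transmitters repeat this sum in the second use,
from which receiver `k` gets the interference of the first use. -/
theorem symAchievable_of_weak {K n m c : ℕ} (h : 3 * m ≤ 2 * n)
    (hc : m - (n - m) + c ≤ min (n - m) m) {F : ℝ≥0∞} (hF : (c : ℝ≥0∞) ≤ 2 * F) {R : ℝ}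
    (hR : 2 * R ≤ (2 * (m - (n - m) + (n - m)) + c : ℕ)) : SymAchievable K n m F R := by
  let L := layered (max n m) (m - (n - m)) m (c := c) (d := n - m)
  refine symAchievable_of_linear (N₁ := 1) (N₂ := 1) (B := Fin c)
    (A := (Fin 2 → Fin (m - (n - m)) → ZMod 2) × (Fin 2 → Fin (n - m) → ZMod 2) ×
      (Fin c → ZMod 2)) (by omega) (by simpa using hF)
    (rpow_le_card (d := 2 * (m - (n - m) + (n - m)) + c) ?_ (by push_cast at hR ⊢; linarith))
    (fun _ => AddMonoidHom.mk' (fun a _ => L (a.1 0, a.2.2, a.2.1 0)) fun a b => ?_)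
    (AddMonoidHom.mk' (fun y i => bitAt (n - m + (m - (n - m)) + (i : ℕ)) (y 0)) fun a b => ?_)
    (AddMonoidHom.mk' (fun a => a.2.2) fun a b => rfl) ?_
    (AddMonoidHom.mk' (fun a _ => L (a.1 1, 0, a.2.1 1)) fun a b => ?_)
    (fun _ => AddMonoidHom.mk' (fun z _ => L (0, z, 0)) fun a b => ?_) ?_
  · simp only [Fintype.card_prod, Fintype.card_pi, Finset.prod_const, Finset.card_univ,
      Fintype.card_fin, ZMod.card, ← pow_mul, ← pow_add]
    congr 1
    ring
  · funext s
    exact map_add L (a.1 0, a.2.2, a.2.1 0) (b.1 0, b.2.2, b.2.1 0)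
  · funext i
    simp
  · intro k a
    funext i
    have hi := i.isLt
    simp only [AddMonoidHom.mk'_apply, L]
    rw [bitAt_crossLink (by omega), if_pos (by omega), bitAt_layered (by omega),
      bitAt_of_le (a.1 0) (by omega), if_pos (by omega), if_neg (by omega), zero_add, add_zero,
      show n - m + (m - (n - m)) + (i : ℕ) - (n - m) - (m - (n - m)) = i by omega, bitAt_coe]
  · funext s
    simpa using map_add L (a.1 1, 0, a.2.1 1) (b.1 1, 0, b.2.1 1)
  · funext s
    simpa using map_add L (0, a, 0) (0, b, 0)
  · intro w k h₁ h₂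
    have hy₁ := layered_eq_zero_of_weak h hc (fun j => ((w j).1 0, (w j).2.2, (w j).2.1 0)) k (h₁ 0)
    have hy₂ := layered_eq_zero_of_weak h hc
      (fun j => ((w j).1 1, ∑ i, (w i).2.2, (w j).2.1 1)) k (by
        rw [← h₂ 0]
        congr 1
        funext j
        simp only [AddMonoidHom.mk'_apply, L, ← map_add]
        simp)
    simp only at hy₁ hy₂
    obtain ⟨hu₀, ha, hv₀⟩ := hy₁
    obtain ⟨hu₁, hS, hv₁⟩ := hy₂
    have hv₁' := hv₁ (by simp [hS])
    have hv₀' := hv₀ (by rw [Finset.sum_erase_eq_sub (Finset.mem_univ k), hS, ha, sub_zero])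
    refine Prod.ext ?_ (Prod.ext ?_ ha)
    · funext s
      fin_cases s
      exacts [hu₀, hu₁]
    · funext s
      fin_cases s
      exacts [hv₀', hv₁']

/-- Decoding for `2 n ≤ m`. The levels between `n` and `m - n` show the interference of the second
block, and the first block arrives below. -/
theorem layered_eq_zero_of_veryStrong {K n m c : ℕ} (hc : 2 * n + c ≤ m)
    (X : Fin K → (Fin n → ZMod 2) × (Fin c → ZMod 2) × (Fin 0 → ZMod 2)) (k : Fin K)
    (h0 : detChannel n m (fun j => layered (max n m) n m (X j)) k = 0) :
    (X k).1 = 0 ∧ ∑ j ∈ Finset.univ.erase k, (X j).2.1 = 0 := by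
  rw [show ∑ j ∈ Finset.univ.erase k, (X j).2.1 = (∑ j ∈ Finset.univ.erase k, X j).2.1 by
    rw [Prod.snd_sum, Prod.fst_sum]]
  have key : ∀ i < m, (if m - n ≤ i then
      bitAt (i - (m - n)) (layered (max n m) n m (X k)) else 0) +
      bitAt i (layered (max n m) n m (∑ j ∈ Finset.univ.erase k, X j)) = 0 := by
    intro i hi
    have h1 := congrArg (bitAt i) h0
    rw [bitAt_detChannel (by omega), map_zero, ← map_sum] at h1
    simpa only [show n - m = 0 by omega, Nat.zero_le, if_true, Nat.sub_zero] using h1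
  generalize ∑ j ∈ Finset.univ.erase k, X j = Y at *
  constructor
  · refine eq_of_bitAt_eq fun i hi => ?_
    have h1 := key (m - n + i) (by omega)
    rw [if_pos (by omega), bitAt_layered (by omega), bitAt_layered (by omega),
      bitAt_of_le Y.1 (by omega), bitAt_of_le Y.2.1 (by omega), Nat.add_sub_cancel_left,
      if_neg (by omega), if_neg (by omega), ite_self, if_neg (by omega)] at h1
    simpa using h1
  · refine eq_of_bitAt_eq fun i hi => ?_
    have h1 := key (n + i) (by omega)
    rw [if_neg (by omega), bitAt_layered (by omega), bitAt_of_le Y.1 (by omega),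
      if_pos (by omega), if_neg (by omega), Nat.add_sub_cancel_left] at h1
    simpa using h1

/-- The invertible combinations in which the users relay a pair `S` of blocks: user `0` sends `S`,
user `1` sends `ω S`, where `ω` generates the field with four elements, and the other users are
silent. The sum over all users but one is then invertible, whatever the number of users. -/
def relay {K c : ℕ} (k : Fin K) : (Fin 2 × Fin c → ZMod 2) →+ (Fin 2 → Fin c → ZMod 2) :=
  AddMonoidHom.mk' (fun S s l =>
    if (k : ℕ) = 0 then S (s, l)
    else if (k : ℕ) = 1 then if s = 0 then S (1, l) else S (0, l) + S (1, l)
    else 0) fun a b => by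
      funext s l
      simp only [Pi.add_apply]
      split_ifs <;> abel

theorem eq_zero_of_sum_relay {K c : ℕ} (hK : 2 ≤ K) (k : Fin K) (S : Fin 2 × Fin c → ZMod 2)
    (h : ∀ s, ∑ j ∈ Finset.univ.erase k, relay j S s = 0) : S = 0 := by
  let k₀ : Fin K := ⟨0, by omega⟩
  let k₁ : Fin K := ⟨1, by omega⟩
  have hne : k₁ ≠ k₀ := by simp [k₀, k₁]
  have hrest : ∀ j : Fin K, j ≠ k₀ → j ≠ k₁ → ∀ s, relay j S s = 0 := by
    intro j h0 h1 s
    have h0' : (j : ℕ) ≠ 0 := fun h => h0 (Fin.ext h)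
    have h1' : (j : ℕ) ≠ 1 := fun h => h1 (Fin.ext h)
    funext l
    simp [relay, h0', h1']
  have htot : ∀ s, ∑ j : Fin K, relay j S s = relay k₀ S s + relay k₁ S s := by
    intro s
    rw [← Finset.sum_subset (Finset.subset_univ {k₀, k₁}), Finset.sum_pair hne.symm]
    intro j _ hj
    simp only [Finset.mem_insert, Finset.mem_singleton, not_or] at hj
    exact hrest j hj.1 hj.2 s
  have key : ∀ s l, relay k₀ S s l + relay k₁ S s l = relay k S s l := by
    intro s l
    have h1 := h s
    rw [Finset.sum_erase_eq_sub (Finset.mem_univ k), htot, sub_eq_zero] at h1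
    exact congrFun h1 l
  have hl : ∀ l, S (0, l) = 0 ∧ S (1, l) = 0 := by
    intro l
    have e0 := key 0 l
    have e1 := key 1 l
    simp only [relay, AddMonoidHom.mk'_apply, k₀, k₁, if_true, one_ne_zero, if_false] at e0 e1
    generalize S (0, l) = x at *
    generalize S (1, l) = y at *
    revert x y
    split_ifs <;> decide
  funext ⟨s, l⟩
  fin_cases s
  exacts [(hl l).1, (hl l).2]

/-- The scheme for `2 n ≤ m`, with `2 c` feedback bits in four channel uses. In the first two uses
`c` levels of an input reach the other receivers only. The feedback tells every transmitter the
sums of these bits, which are relayed in the last two uses. -/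
theorem symAchievable_of_veryStrong {K n m c : ℕ} (hK : 2 ≤ K) (hc : 2 * n + c ≤ m) {F : ℝ≥0∞}
    (hF : (c : ℝ≥0∞) ≤ 2 * F) {R : ℝ} (hR : 2 * R ≤ (2 * n + c : ℕ)) :
    SymAchievable K n m F R := by
  let L := layered (max n m) n m (c := c) (d := 0)
  refine symAchievable_of_linear (N₁ := 2) (N₂ := 2) (B := Fin 2 × Fin c)
    (A := (Fin 2 → Fin 2 → Fin n → ZMod 2) × (Fin 2 × Fin c → ZMod 2)) (by omega) ?_
    (rpow_le_card (d := 4 * n + 2 * c) ?_ (by push_cast at hR ⊢; linarith))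
    (fun _ => AddMonoidHom.mk' (fun a s => L (a.1 0 s, fun l => a.2 (s, l), 0)) fun a b => ?_)
    (AddMonoidHom.mk' (fun y i => bitAt (n + (i.2 : ℕ)) (y i.1)) fun a b => ?_)
    (AddMonoidHom.mk' (fun a => a.2) fun a b => rfl) ?_
    (AddMonoidHom.mk' (fun a s => L (a.1 1 s, 0, 0)) fun a b => ?_)
    (fun k => AddMonoidHom.mk' (fun z s => L (0, relay k z s, 0)) fun a b => ?_) ?_
  · simp only [Fintype.card_prod, Fintype.card_fin]
    calc ((2 * c : ℕ) : ℝ≥0∞) = 2 * c := by push_cast; rfl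
      _ ≤ 2 * (2 * F) := by gcongr
      _ = ((2 + 2 : ℕ) : ℝ≥0∞) * F := by rw [← mul_assoc]; norm_num
  · simp only [Fintype.card_prod, Fintype.card_pi, Finset.prod_const, Finset.card_univ,
      Fintype.card_fin, ZMod.card, ← pow_mul, ← pow_add]
    congr 1
    ring
  · funext s
    exact map_add L (a.1 0 s, fun l => a.2 (s, l), 0) (b.1 0 s, fun l => b.2 (s, l), 0)
  · funext i
    simp
  · intro k a
    funext ⟨s, i⟩
    have hi := i.isLt
    simp only [AddMonoidHom.mk'_apply, L]
    rw [bitAt_crossLink (by omega), if_pos (by omega), bitAt_layered (by omega),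
      bitAt_of_le (a.1 0 s) (by omega), if_pos (by omega), if_neg (by omega), zero_add, add_zero,
      show n + (i : ℕ) - (n - m) - n = i by omega, bitAt_coe]
  · funext s
    simpa using map_add L (a.1 1 s, 0, 0) (b.1 1 s, 0, 0)
  · funext s
    simpa using map_add L (0, relay k a s, 0) (0, relay k b s, 0)
  · intro w k h₁ h₂
    have hy₁ := fun s => layered_eq_zero_of_veryStrong hc
      (fun j => ((w j).1 0 s, fun l => (w j).2 (s, l), 0)) k (h₁ s)
    have hy₂ := fun s => layered_eq_zero_of_veryStrong hc
      (fun j => ((w j).1 1 s, relay j (∑ i, (w i).2) s, 0)) k (by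
        rw [← h₂ s]
        congr 1
        funext j
        simp only [AddMonoidHom.mk'_apply, L, ← map_add]
        simp)
    have hS := eq_zero_of_sum_relay hK k _ fun s => (hy₂ s).2
    refine Prod.ext ?_ ?_
    · funext r s
      fin_cases r
      exacts [(hy₁ s).1, (hy₂ s).1]
    · have hT : ∑ j ∈ Finset.univ.erase k, (w j).2 = 0 := by
        funext ⟨s, l⟩
        have h3 := congrFun (hy₁ s).2 l
        simpa using h3
      have h3 := Finset.sum_erase_eq_sub (f := fun j => (w j).2) (Finset.mem_univ k)
      rw [hT, hS, zero_sub] at h3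
      exact neg_eq_zero.1 h3.symm

/-! ### The symmetric capacities -/

/-- The piecewise rate is achievable with feedback of `b / 2` bits per channel use. -/
theorem symAchievable_symRate {K n m : ℕ} (hK : 2 ≤ K) (b : ℕ) (p : ℝ≥0) (hp : 2 * p = b) :
    SymAchievable K n m p (symRate K n m p) := by
  have hp' : 2 * (p : ℝ) = b := by exact_mod_cast congrArg NNReal.toReal hp
  have hF : ∀ c ≤ b, (c : ℝ≥0∞) ≤ 2 * (p : ℝ≥0∞) := by
    intro c hc
    have h1 : (2 : ℝ≥0∞) * p = (b : ℝ≥0∞) := by exact_mod_cast congrArg ENNReal.ofNNReal hp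
    rw [h1]
    exact_mod_cast hc
  unfold symRate
  split_ifs with h1 h2 h3 h4 h5
  · refine symAchievable_of_weak (c := min b m) (by omega) (by omega) (hF _ (min_le_left _ _)) ?_
    have h : ((2 * (m - (n - m) + (n - m)) + min b m : ℕ) : ℝ) =
        2 * ((n : ℝ) - m) + min (b : ℝ) m := by
      rw [show m - (n - m) + (n - m) = n - m by omega]
      push_cast [Nat.cast_sub (show m ≤ n by omega)]
      rfl
    rw [h, mul_min_of_nonneg _ _ (by norm_num), ← min_add_add_left]
    apply min_le_min <;> linarith
  · refine symAchievable_of_weak (c := min b (2 * n - 3 * m)) (by omega) (by omega)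
      (hF _ (min_le_left _ _)) ?_
    have h : ((2 * (m - (n - m) + (n - m)) + min b (2 * n - 3 * m) : ℕ) : ℝ) =
        2 * (m : ℝ) + min (b : ℝ) (2 * n - 3 * m) := by
      rw [show m - (n - m) + (n - m) = m by omega]
      push_cast [Nat.cast_sub h2]
      rfl
    rw [h, mul_min_of_nonneg _ _ (by norm_num), ← min_add_add_left]
    apply min_le_min <;> linarith
  · exact symAchievable_of_moderate (by omega) h3 _
  · subst h4
    exact symAchievable_of_eq hK _
  · exact symAchievable_of_strong (by omega) h5 _
  · refine symAchievable_of_veryStrong hK (c := min b (m - 2 * n)) (by omega)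
      (hF _ (min_le_left _ _)) ?_
    have h : ((2 * n + min b (m - 2 * n) : ℕ) : ℝ) = 2 * (n : ℝ) + min (b : ℝ) (m - 2 * n) := by
      push_cast [Nat.cast_sub (show 2 * n ≤ m by omega)]
      rfl
    rw [h, mul_min_of_nonneg _ _ (by norm_num), ← min_add_add_left]
    apply min_le_min <;> linarith

/-- For feedback capacity at least `n + m` the piecewise rate no longer depends on it, and it is the
capacity with unlimited feedback. -/
theorem SymAchievable.le_symRate_large {K n m : ℕ} (hK : 2 ≤ K) {F : ℝ≥0∞} {R : ℝ}
    (h : SymAchievable K n m F R) : R ≤ symRate K n m (n + m) := by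
  have h2 := h.two_mul_le hK
  have hn : (0 : ℝ) ≤ n := n.cast_nonneg
  have hm : (0 : ℝ) ≤ m := m.cast_nonneg
  have hw : m ≤ n → 2 * R ≤ 2 * n - m := fun hmn => by
    rw [max_eq_left hmn] at h2
    push_cast [Nat.cast_sub hmn] at h2
    linarith
  have hs : n ≤ m → 2 * R ≤ m := fun hnm => by
    rwa [max_eq_right hnm, Nat.sub_eq_zero_of_le hnm, add_zero] at h2
  unfold symRate
  split_ifs with h1 h3 h4 h5 h6
  · have := hw (by omega)
    apply le_min <;> linarith
  · have := hw (by omega)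
    apply le_min <;> linarith
  · have := hw (by omega)
    linarith
  · subst h5
    exact h.le_div_of_eq hK
  · have := hs (by omega)
    linarith
  · have := hs (by omega)
    apply le_min <;> linarith

theorem SymAchievable.le_symRate_zero {K n m : ℕ} (hK : 2 ≤ K) {R : ℝ}
    (h : SymAchievable K n m 0 R) : R ≤ symRate K n m 0 := by
  have hR := h.le_symRate_large hK
  unfold symRate at hR ⊢
  split_ifs at hR ⊢ with h1 h3 h4 h5 h6
  · refine le_min ?_ (hR.trans (min_le_right _ _))
    have h7 := h.le_max hK (by omega)
    rw [max_eq_right (by omega), Nat.cast_sub (by omega)] at h7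
    linarith
  · refine le_min ?_ (hR.trans (min_le_right _ _))
    have h7 := h.le_max hK (by omega)
    rw [max_eq_left (by omega)] at h7
    linarith
  · exact hR
  · exact hR
  · exact hR
  · refine le_min ?_ (hR.trans (min_le_right _ _))
    rw [add_zero]
    exact h.le_direct hK (by omega)

theorem symRate_eq_min (K n m : ℕ) {p : ℝ} (hp : 0 ≤ p) :
    symRate K n m p = min (symRate K n m (n + m)) (symRate K n m 0 + p) := by
  have hn : (0 : ℝ) ≤ n := n.cast_nonneg
  have hm : (0 : ℝ) ≤ m := m.cast_nonneg
  unfold symRate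
  split_ifs with h1 h3 h4 h5 h6
  · rw [min_eq_right (a := (n : ℝ) - m + (n + m)) (by linarith),
      min_eq_left (a := (n : ℝ) - m + 0) (by linarith), add_zero, min_comm]
  · have h7 : 3 * (m : ℝ) ≤ 2 * n := by exact_mod_cast h3
    rw [min_eq_right (a := (m : ℝ) + (n + m)) (by linarith),
      min_eq_left (a := (m : ℝ) + 0) (by linarith), add_zero, min_comm]
  · exact (min_eq_left (by linarith)).symm
  · exact (min_eq_left (by linarith)).symm
  · exact (min_eq_left (by linarith)).symm
  · have h7 : 2 * (n : ℝ) < m := by exact_mod_cast not_le.1 h6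
    rw [min_eq_right (a := (n : ℝ) + (n + m)) (by linarith),
      min_eq_left (a := (n : ℝ) + 0) (by linarith), add_zero, min_comm]

theorem mainTheorem2 (K n m : ℕ) (hK : 2 ≤ K) (p : ℝ≥0) (hp : ∃ b : ℕ, 2 * p = b) :
    SymAchievable K n m p (symRate K n m p) ∧
      ∃ Cinf Czero : ℝ, IsSymCapacity K n m ⊤ Cinf ∧ IsSymCapacity K n m 0 Czero ∧
        symRate K n m p = min Cinf (Czero + p) := by
  obtain ⟨b, hb⟩ := hp
  refine ⟨symAchievable_symRate hK b p hb, symRate K n m (n + m), symRate K n m 0,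
    IsGreatest.isLUB ⟨?_, fun R hR => hR.le_symRate_large hK⟩,
    IsGreatest.isLUB ⟨?_, fun R hR => hR.le_symRate_zero hK⟩, symRate_eq_min K n m p.2⟩
  · have h := symAchievable_symRate (n := n) (m := m) hK (2 * (n + m)) ((n : ℝ≥0) + m) (by simp)
    exact h.mono le_top
  · have h := symAchievable_symRate (n := n) (m := m) hK 0 0 (by simp)
    exact h
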